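/- **Theorem 1.3.** Let $p$ be an odd prime and let $x\in\mathbb{Z}_p$ be a $p$-adic integer. Let $\langle x\rangle_p\in\{0,1,\dots,p-1\}$ be the least nonnegative residue of $x$ modulo $p$, and write $x=\langle x\rangle_p+pt$ with $t\in\mathbb{Z}_p$. Then $$(2x+1)\sum_{k=0}^{p-1}\frac{\binom{x}{k}\binom{x+k}{k}(-2)^k}{(2k+1)\binom{2k}{k}}\equiv(-1)^{\lfloor\langle x\rangle_p/2\rfloor}\left(1+t+(-1)^{\langle x\rangle_p}\left(\frac{-1}{p}\right)t\right)+\frac{pt(t+1)}{2}\left(E_{p-2}\left(\frac{x+1}{2}\right)-E_{p-2}\left(-\frac{x}{2}\right)\right)\pmod{p^2}.$$ Here $\binom{y}{k}=y(y-1)\cdots(y-k+1)/k!$, $\left(\frac{\cdot}{p}\right)$ is the Legendre symbol, $E_n(X)\in\mathbb{Q}[X]$ are the Euler polynomials, given by $\frac{2e^{Xz}}{e^z+1}=\sum_{n\ge0}E_n(X)\frac{z^n}{n!}$, and the congruence means that the difference of the two sides, computed in $\mathbb{Q}_p$, lies in $p^2\mathbb{Z}_p$. -/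

import Mathlib

/-- The Euler polynomial `E_n(X)`, defined by the generating function
`2 e^{Xz} / (e^z + 1) = ∑ E_n(X) z^n / n!`, read in formal power series in `z` over `ℚ[X]`.
The inverse is taken in `ℚ⟦z⟧`, where `e^z + 1` has constant term `2 ≠ 0`. -/
noncomputable def eulerPoly (n : ℕ) : Polynomial ℚ :=
  n.factorial • PowerSeries.coeff n
    (2 * PowerSeries.rescale (Polynomial.X : Polynomial ℚ) (PowerSeries.exp (Polynomial ℚ)) *
      PowerSeries.map (Polynomial.C : ℚ →+* Polynomial ℚ) (PowerSeries.exp ℚ + 1)⁻¹)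

/-- The exponential generating function of the Euler polynomials, with the denominator
cleared. -/
theorem eulerPoly_generating :
    (PowerSeries.mk fun n => (1 / n.factorial : ℚ) • eulerPoly n) *
        (PowerSeries.exp (Polynomial ℚ) + 1) =
      2 * PowerSeries.rescale (Polynomial.X : Polynomial ℚ)
        (PowerSeries.exp (Polynomial ℚ)) := by
  have h0 : PowerSeries.constantCoeff (PowerSeries.exp ℚ + 1) ≠ 0 := by
    simp
  have h1 : (PowerSeries.mk fun n => (1 / n.factorial : ℚ) • eulerPoly n) =
      2 * PowerSeries.rescale (Polynomial.X : Polynomial ℚ) (PowerSeries.exp (Polynomial ℚ)) *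
        PowerSeries.map (Polynomial.C : ℚ →+* Polynomial ℚ) (PowerSeries.exp ℚ + 1)⁻¹ := by
    ext1 n
    have hn : (n.factorial : ℚ) ≠ 0 := by exact_mod_cast n.factorial_ne_zero
    rw [PowerSeries.coeff_mk, eulerPoly, ← Nat.cast_smul_eq_nsmul ℚ, smul_smul,
      one_div_mul_cancel hn, one_smul]
  have h2 : PowerSeries.exp (Polynomial ℚ) + 1 =
      PowerSeries.map (Polynomial.C : ℚ →+* Polynomial ℚ) (PowerSeries.exp ℚ + 1) := by
    simp [PowerSeries.map_exp]
  rw [h1, h2, mul_assoc, ← map_mul, PowerSeries.inv_mul_cancel _ h0, map_one, mul_one]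

section

open Finset

/-! ### The summands as division-free odd binomials. -/

section BinomialRing

variable {R : Type*} [CommRing R] [BinomialRing R]

/-! The left side is `S(x) = oddBinomSum p x`, an integral combination of binomials. It satisfies
`S(-1 - x) = -S(x)`, and `S(x + 1) + S(x - 1)` telescopes to a single boundary term, so `S(n) = (-1)
^ (n / 2)` for naturals `n < p`.

Factorials below `2p` divide `p` in `ℤ_[p]`, so `p * S` is a polynomial over `ℤ_[p]`. Hence `h ↦ S(a
+ p h)` is quadratic modulo `p ^ 2` (`exists_oddBinomSum_quadratic`), determined by `S(a)`, `S(a -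
p)` and the second difference `D(a) = oddBinomSumDiff a`. The first two values give the main term,
with the Legendre symbol coming from reflection at `a - p`.

The Euler term is `D` (`oddBinomSumDiff_modEq`): modulo `p ^ 2`, on integers, both `D(x)` and `p
(E((x + 1) / 2) - E(-x / 2))` have period `p` and the same sum of values at `x + 1` and `x - 1`,
namely `4 p (x ^ (p - 2) + (x + 1) ^ (p - 2))`. Their difference changes sign under `x ↦ x + 2`; as
`p` is odd, periodicity forces it to vanish. -/

theorem succ_mul_ringChoose_succ (x : R) (k : ℕ) :
    ((k : R) + 1) * Ring.choose x (k + 1) = (x - k) * Ring.choose x k := by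
  have h := Ring.choose_smul_choose x (Nat.le_succ k)
  rw [Nat.succ_eq_add_one, Nat.choose_succ_self_right, Nat.add_sub_cancel_left,
    Ring.choose_one_right, nsmul_eq_mul] at h
  push_cast at h
  rw [h, mul_comm]

/-- The polynomial `(2 x + 1) / (2 k + 1) * choose (x + k) (2 k)`, written without division. -/
noncomputable def oddBinom (k : ℕ) (x : R) : R :=
  Ring.choose (x + k) (2 * k) + 2 * Ring.choose (x + k) (2 * k + 1)

theorem mul_oddBinom (k : ℕ) (x : R) :
    (2 * (k : R) + 1) * oddBinom k x = (2 * x + 1) * Ring.choose (x + k) (2 * k) := by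
  have h := succ_mul_ringChoose_succ (x + k) (2 * k)
  rw [oddBinom]
  push_cast at h
  linear_combination 2 * h

theorem oddBinom_zero_left (x : R) : oddBinom 0 x = 2 * x + 1 := by
  simp only [oddBinom, Nat.cast_zero, add_zero, mul_zero, Ring.choose_zero_right, zero_add,
    Ring.choose_one_right]
  ring

theorem oddBinom_natCast (k n : ℕ) :
    oddBinom k (n : R) = (((n + k).choose (2 * k) + 2 * (n + k).choose (2 * k + 1) : ℕ) : R) := by
  rw [oddBinom, ← Nat.cast_add, Ring.choose_natCast, Ring.choose_natCast]
  push_cast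
  ring

theorem oddBinom_natCast_of_lt {k n : ℕ} (h : n < k) : oddBinom k (n : R) = 0 := by
  rw [oddBinom_natCast, Nat.choose_eq_zero_of_lt (by omega), Nat.choose_eq_zero_of_lt (by omega)]
  simp

/-- Under `x ↦ -1 - x` the factor `2 x + 1` is odd and `choose (x + k) (2 k)` is even; upper
negation shows this without dividing by `2 k + 1`. -/
theorem oddBinom_reflect (k : ℕ) (x : R) : oddBinom k (-1 - x) = -oddBinom k x := by
  have h1 : Ring.choose (-1 - x + k) (2 * k) = Ring.choose (x + k) (2 * k) := by
    rw [show -1 - x + (k : R) = -(x + 1 - k) by ring, Ring.choose_neg]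
    rw [show x + 1 - (k : R) + (2 * k : ℕ) - 1 = x + k by push_cast; ring]
    simp [Int.negOnePow_even]
  have h2 : Ring.choose (-1 - x + k) (2 * k + 1) =
      -(Ring.choose (x + k) (2 * k) + Ring.choose (x + k) (2 * k + 1)) := by
    rw [show -1 - x + (k : R) = -(x + 1 - k) by ring, Ring.choose_neg]
    rw [show x + 1 - (k : R) + (2 * k + 1 : ℕ) - 1 = x + k + 1 by push_cast; ring,
      Ring.choose_succ_succ]
    rw [Int.negOnePow_odd _ (by push_cast; exact odd_two_mul_add_one _), Units.neg_smul, one_smul]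
  rw [oddBinom, oddBinom, h1, h2]
  ring

theorem ringChoose_second_difference (y : R) (k : ℕ) :
    Ring.choose (y + 2) (k + 2) - 2 * Ring.choose (y + 1) (k + 2) + Ring.choose y (k + 2) =
      Ring.choose y k := by
  rw [show y + 2 = y + 1 + 1 by ring, Ring.choose_succ_succ (y + 1), Ring.choose_succ_succ y,
    Ring.choose_succ_succ y]
  ring

theorem oddBinom_second_difference (k : ℕ) (x : R) :
    oddBinom (k + 1) (x + 1) - 2 * oddBinom (k + 1) x + oddBinom (k + 1) (x - 1) =
      oddBinom k x := by
  have h1 := ringChoose_second_difference (x + k) (2 * k)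
  have h2 := ringChoose_second_difference (x + k) (2 * k + 1)
  simp only [oddBinom]
  rw [show x + 1 + ((k + 1 : ℕ) : R) = x + k + 2 by push_cast; ring,
    show x + ((k + 1 : ℕ) : R) = x + k + 1 by push_cast; ring,
    show x - 1 + ((k + 1 : ℕ) : R) = x + k by push_cast; ring,
    show 2 * (k + 1) = 2 * k + 2 by ring]
  rw [show 2 * k + 2 + 1 = 2 * k + 1 + 2 by ring]
  linear_combination h1 + 2 * h2

/-- The truncated expansion of `sin ((2 x + 1) π / 4) / sin (π / 4)`. -/
noncomputable def oddBinomSum (n : ℕ) (x : R) : R :=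
  ∑ k ∈ range n, (-2) ^ k * oddBinom k x

theorem oddBinomSum_reflect (n : ℕ) (x : R) : oddBinomSum n (-1 - x) = -oddBinomSum n x := by
  simp only [oddBinomSum, oddBinom_reflect, mul_neg, sum_neg_distrib]

/-- By the second difference, the term of index `k + 1` contributes `(-2) ^ (k + 1) * (f k + 2 * f
(k + 1))` with `f k = oddBinom k x`; the weights make this telescope. -/
theorem oddBinomSum_add_one_add_sub_one (n : ℕ) (x : R) :
    oddBinomSum (n + 1) (x + 1) + oddBinomSum (n + 1) (x - 1) = 2 * (-2) ^ n * oddBinom n x := by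
  induction n with
  | zero => simp [oddBinomSum, oddBinom_zero_left]; ring
  | succ n ih =>
    have h := oddBinom_second_difference n x
    simp only [oddBinomSum] at ih ⊢
    rw [sum_range_succ, sum_range_succ _ (n + 1)]
    linear_combination ih + (-2) ^ (n + 1) * h

theorem oddBinomSum_natCast {m n : ℕ} (h : n < m) (hm : 2 ≤ m) :
    oddBinomSum m (n : R) = (-1) ^ (n / 2) := by
  induction n using Nat.strong_induction_on with
  | _ n ih =>
    match n with
    | 0 =>
      rw [oddBinomSum, sum_eq_single_of_mem 0 (mem_range.2 h)]
      · simp [oddBinom_zero_left]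
      · intro k _ hk
        rw [oddBinom_natCast_of_lt (Nat.pos_of_ne_zero hk), mul_zero]
    | 1 =>
      have h0 : ∀ k ∈ range m, k ∉ range 2 → (-2) ^ k * oddBinom k ((1 : ℕ) : R) = 0 := by
        intro k _ hk
        rw [oddBinom_natCast_of_lt (by simpa using hk), mul_zero]
      rw [oddBinomSum, ← sum_subset (range_subset_range.2 hm) h0]
      simp only [oddBinom_natCast]
      norm_num [sum_range_succ, Nat.choose]
    | n + 2 =>
      obtain ⟨m, rfl⟩ : ∃ l, m = l + 1 := ⟨m - 1, by omega⟩
      have h1 := oddBinomSum_add_one_add_sub_one m ((n + 1 : ℕ) : R)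
      -- The boundary term vanishes at `n + 1`, so a shift by 2 flips the sign.
      rw [oddBinom_natCast_of_lt (by omega)] at h1
      have h2 := ih n (by omega) (by omega)
      rw [show ((n + 1 : ℕ) : R) + 1 = (n + 2 : ℕ) by push_cast; ring,
        show ((n + 1 : ℕ) : R) - 1 = n by push_cast; ring, h2] at h1
      rw [show (n + 2) / 2 = n / 2 + 1 by omega, pow_succ]
      linear_combination h1

theorem oddBinom_self (k : ℕ) : oddBinom k (k : R) = 1 := by
  rw [oddBinom_natCast, ← two_mul, Nat.choose_self, Nat.choose_eq_zero_of_lt (by omega)]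
  simp

theorem oddBinom_succ_self (k : ℕ) : oddBinom k ((k + 1 : ℕ) : R) = 2 * k + 3 := by
  rw [oddBinom_natCast, show k + 1 + k = 2 * k + 1 by ring, Nat.choose_self,
    Nat.choose_succ_self_right]
  push_cast
  ring

end BinomialRing

/-! ### Euler polynomials: functional equation and `p`-integrality. -/

theorem sum_choose_mul_eulerPoly (n : ℕ) :
    ∑ k ∈ range (n + 1), (n.choose k : Polynomial ℚ) * eulerPoly k + eulerPoly n =
      2 * Polynomial.X ^ n := by
  have h := congrArg (PowerSeries.coeff n) eulerPoly_generating
  have hn : (n.factorial : ℚ) ≠ 0 := by exact_mod_cast n.factorial_ne_zero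
  rw [mul_add, mul_one, map_add, PowerSeries.coeff_mul,
    Finset.Nat.sum_antidiagonal_eq_sum_range_succ_mk, PowerSeries.coeff_mk,
    show (2 : PowerSeries (Polynomial ℚ)) = PowerSeries.C 2 from (map_ofNat PowerSeries.C 2).symm,
    PowerSeries.coeff_C_mul, PowerSeries.coeff_rescale, PowerSeries.coeff_exp] at h
  simp only [PowerSeries.coeff_mk, PowerSeries.coeff_exp] at h
  have h' := congrArg (fun q => (n.factorial : ℚ) • q) h
  simp only [smul_add, smul_sum] at h'
  convert h' using 1
  · congr 1
    · refine sum_congr rfl fun k hk => ?_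
      have hk' : k ≤ n := by simpa [Nat.lt_succ_iff] using hk
      have e : (algebraMap ℚ (Polynomial ℚ)) (1 / ((n - k).factorial : ℚ)) =
          Polynomial.C (1 / ((n - k).factorial : ℚ)) := rfl
      rw [e, smul_mul_assoc, smul_smul, mul_comm (eulerPoly k), ← Polynomial.smul_eq_C_mul,
        smul_smul, ← Polynomial.C_eq_natCast, ← Polynomial.smul_eq_C_mul, Nat.cast_choose ℚ hk']
      congr 1
      field_simp
    · rw [smul_smul, mul_one_div_cancel hn, one_smul]
  · have e : (algebraMap ℚ (Polynomial ℚ)) (1 / (n.factorial : ℚ)) =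
        Polynomial.C (1 / (n.factorial : ℚ)) := rfl
    rw [e, mul_comm (Polynomial.X ^ n), ← Polynomial.smul_eq_C_mul, mul_smul_comm, smul_smul,
      mul_one_div_cancel hn, one_smul]

theorem two_mul_eulerPoly (n : ℕ) :
    2 * eulerPoly n = 2 * Polynomial.X ^ n -
      ∑ k ∈ range n, (n.choose k : Polynomial ℚ) * eulerPoly k := by
  have h := sum_choose_mul_eulerPoly n
  rw [sum_range_succ, Nat.choose_self, Nat.cast_one, one_mul] at h
  linear_combination h

theorem aeval_eulerPoly_add_one_add {A : Type*} [Field A] [CharZero A] [Algebra ℚ A]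
    (n : ℕ) (y : A) :
    Polynomial.aeval (y + 1) (eulerPoly n) + Polynomial.aeval y (eulerPoly n) = 2 * y ^ n := by
  induction n using Nat.strong_induction_on with
  | _ n ih =>
    have hr : ∀ z : A, 2 * Polynomial.aeval z (eulerPoly n) =
        2 * z ^ n - ∑ k ∈ range n, (n.choose k : A) * Polynomial.aeval z (eulerPoly k) := by
      intro z
      simpa [map_ofNat (Polynomial.aeval z) 2] using
        congrArg (Polynomial.aeval z) (two_mul_eulerPoly n)
    have hs : ∑ k ∈ range n, (n.choose k : A) * Polynomial.aeval (y + 1) (eulerPoly k) +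
        ∑ k ∈ range n, (n.choose k : A) * Polynomial.aeval y (eulerPoly k) =
        2 * ((y + 1) ^ n - y ^ n) := by
      rw [← sum_add_distrib, add_pow, sum_range_succ]
      simp only [one_pow, mul_one, Nat.choose_self, Nat.cast_one, add_sub_cancel_right, mul_sum]
      refine sum_congr rfl fun k hk => ?_
      rw [← mul_add, ih k (mem_range.1 hk)]
      ring
    have h2 : (2 : A) ≠ 0 := two_ne_zero
    apply mul_left_cancel₀ h2
    linear_combination hr (y + 1) + hr y - hs

theorem exists_padicInt_half {p : ℕ} [Fact p.Prime] (hp : Odd p) : ∃ i : ℤ_[p], 2 * i = 1 := by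
  obtain ⟨m, hm⟩ := hp
  have hu : IsUnit (2 : ℤ_[p]) := by
    rw [PadicInt.isUnit_iff]
    refine le_antisymm (PadicInt.norm_le_one _) (not_lt.1 fun h => ?_)
    have h' := (PadicInt.norm_int_lt_one_iff_dvd (p := p) 2).1 (by exact_mod_cast h)
    have h3 := Int.le_of_dvd two_pos h'
    have := (Fact.out : p.Prime).two_le
    omega
  exact hu.exists_right_inv

/-- The recurrence `two_mul_eulerPoly` divides only by 2, a unit of `ℤ_[p]`. -/
theorem exists_padicInt_eulerPoly {p : ℕ} [Fact p.Prime] (hp : Odd p) (n : ℕ) :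
    ∃ Q : Polynomial ℤ_[p], ∀ y : ℤ_[p],
      Polynomial.aeval (y : ℚ_[p]) (eulerPoly n) = (Q.eval y : ℤ_[p]) := by
  obtain ⟨i, hi⟩ := exists_padicInt_half hp
  have hi' : (2 : ℚ_[p]) * i = 1 := by exact_mod_cast congrArg ((↑) : ℤ_[p] → ℚ_[p]) hi
  induction n using Nat.strong_induction_on with
  | _ n ih =>
    choose! Q hQ using ih
    refine ⟨Polynomial.C i * (2 * Polynomial.X ^ n -
      ∑ k ∈ range n, (n.choose k : Polynomial ℤ_[p]) * Q k), fun y => ?_⟩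
    have h := congrArg (Polynomial.aeval (y : ℚ_[p])) (two_mul_eulerPoly n)
    simp only [map_mul, map_sub, map_sum, map_natCast, map_pow, Polynomial.aeval_X,
      map_ofNat] at h
    rw [sum_congr rfl fun k hk => by rw [hQ k (mem_range.1 hk) y]] at h
    simp only [Polynomial.eval_mul, Polynomial.eval_C, Polynomial.eval_sub, Polynomial.eval_pow,
      Polynomial.eval_X, Polynomial.eval_finsetSum, Polynomial.eval_natCast,
      Polynomial.eval_ofNat]
    rw [PadicInt.coe_mul, PadicInt.coe_sub, PadicInt.coe_mul, PadicInt.coe_sum,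
      show ((2 : ℤ_[p]) : ℚ_[p]) = 2 from rfl]
    push_cast
    linear_combination (i : ℚ_[p]) * h - Polynomial.aeval (y : ℚ_[p]) (eulerPoly n) * hi'

/-! ### The sum along a residue class: quadratic modulo `p ^ 2`. -/

section Padic

variable {p : ℕ} [Fact p.Prime]

theorem exists_eval_eq_factorial_mul_choose (j : ℕ) :
    ∃ Q : Polynomial ℤ_[p], ∀ y, Q.eval y = (j.factorial : ℤ_[p]) * Ring.choose y j := by
  induction j with
  | zero => exact ⟨1, fun y => by simp⟩
  | succ j ih =>
    obtain ⟨Q, hQ⟩ := ih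
    refine ⟨Q * (Polynomial.X - (j : Polynomial ℤ_[p])), fun y => ?_⟩
    simp only [Polynomial.eval_mul, Polynomial.eval_sub, Polynomial.eval_X,
      Polynomial.eval_natCast, hQ, Nat.factorial_succ]
    push_cast
    linear_combination (-(j.factorial : ℤ_[p])) * succ_mul_ringChoose_succ y j

theorem isUnit_natCast_of_not_dvd {n : ℕ} (h : ¬ p ∣ n) : IsUnit (n : ℤ_[p]) := by
  rw [PadicInt.isUnit_iff]
  refine le_antisymm (PadicInt.norm_le_one _) (not_lt.1 fun h' => h ?_)
  have h2 := (PadicInt.norm_int_lt_one_iff_dvd (p := p) (n : ℤ)).1 (by exact_mod_cast h')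
  exact_mod_cast h2

/-- Legendre's digit-sum formula, with at most two digits and leading digit at most 1. -/
theorem not_sq_dvd_factorial {j : ℕ} (hj : j < 2 * p) :
    ¬ p ^ 2 ∣ j.factorial := by
  have hp := (Fact.out : p.Prime)
  intro h
  have h2 := (hp.pow_dvd_iff_le_factorization (Nat.factorial_ne_zero j)).1 h
  rw [Nat.factorization_def _ hp] at h2
  have h3 := sub_one_mul_padicValNat_factorial (p := p) j
  have h4 : j / p ≤ 1 := Nat.lt_succ_iff.1 ((Nat.div_lt_iff_lt_mul hp.pos).2 hj)
  have h5 : (p.digits j).sum + (p - 1) * 1 ≥ j := by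
    rcases Nat.lt_or_ge j p with hlt | hge
    · rcases Nat.eq_zero_or_pos j with rfl | hpos
      · simp
      · rw [Nat.digits_of_lt p j hpos.ne' hlt]; simp
    · have hj1 : j / p = 1 := le_antisymm h4 ((Nat.one_le_div_iff hp.pos).2 hge)
      have hj2 := Nat.mod_add_div j p
      rw [Nat.digits_def' hp.one_lt (by omega), hj1,
        Nat.digits_of_lt p 1 one_ne_zero hp.one_lt]
      rw [hj1, mul_one] at hj2
      simp only [List.sum_cons, List.sum_nil]
      omega
  have h6 : (p - 1) * 2 ≤ (p - 1) * padicValNat p j.factorial := Nat.mul_le_mul_left _ h2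
  have := hp.two_le
  omega

theorem factorial_dvd_prime {j : ℕ} (hj : j < 2 * p) : (j.factorial : ℤ_[p]) ∣ (p : ℤ_[p]) := by
  have hp := (Fact.out : p.Prime)
  have h := not_sq_dvd_factorial hj
  by_cases h1 : p ∣ j.factorial
  · obtain ⟨v, hv⟩ := h1
    have hv' : ¬ p ∣ v := fun ⟨w, hw⟩ => h ⟨w, by rw [hv, hw]; ring⟩
    rw [hv, Nat.cast_mul]
    exact (isUnit_natCast_of_not_dvd hv').mul_right_dvd.2 dvd_rfl
  · exact (isUnit_natCast_of_not_dvd h1).dvd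

theorem exists_eval_eq_prime_mul_choose {j : ℕ} (hj : j < 2 * p) :
    ∃ Q : Polynomial ℤ_[p], ∀ y, Q.eval y = (p : ℤ_[p]) * Ring.choose y j := by
  obtain ⟨Q, hQ⟩ := exists_eval_eq_factorial_mul_choose (p := p) j
  obtain ⟨c, hc⟩ := factorial_dvd_prime hj
  exact ⟨Polynomial.C c * Q, fun y => by
    rw [Polynomial.eval_mul, Polynomial.eval_C, hQ, hc]; ring⟩

theorem exists_eval_eq_prime_mul_oddBinomSum :
    ∃ Q : Polynomial ℤ_[p], ∀ y, Q.eval y = (p : ℤ_[p]) * oddBinomSum p y := by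
  have h : ∀ k ∈ range p, ∃ Q : Polynomial ℤ_[p], ∀ y, Q.eval y = (p : ℤ_[p]) * oddBinom k y := by
    intro k hk
    have hk' := mem_range.1 hk
    obtain ⟨Q₁, h₁⟩ := exists_eval_eq_prime_mul_choose (p := p) (j := 2 * k) (by omega)
    obtain ⟨Q₂, h₂⟩ := exists_eval_eq_prime_mul_choose (p := p) (j := 2 * k + 1) (by omega)
    refine ⟨(Q₁ + 2 * Q₂).comp (Polynomial.X + (k : Polynomial ℤ_[p])), fun y => ?_⟩
    simp only [Polynomial.eval_comp, Polynomial.eval_add, Polynomial.eval_mul, Polynomial.eval_X,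
      Polynomial.eval_natCast, Polynomial.eval_ofNat, h₁, h₂, oddBinom]
    ring
  choose! Q hQ using h
  refine ⟨∑ k ∈ range p, Polynomial.C ((-2) ^ k) * Q k, fun y => ?_⟩
  rw [Polynomial.eval_finsetSum, oddBinomSum, mul_sum]
  refine sum_congr rfl fun k hk => ?_
  rw [Polynomial.eval_mul, Polynomial.eval_C, hQ k hk]
  ring

theorem exists_eval_add_eq_quadratic {R : Type*} [CommRing R] (Q : Polynomial R) (a : R) :
    ∃ α β : R, ∀ h, h ^ 3 ∣ Q.eval (a + h) - (Q.eval a + α * h + β * h ^ 2) := by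
  set S := Q.comp (Polynomial.X + Polynomial.C a) with hS
  have hev : ∀ h, Q.eval (a + h) = S.eval h := fun h => by
    simp [hS, Polynomial.eval_comp, add_comm]
  have hd : ∀ (T : Polynomial R) (h : R), T.eval h = T.divX.eval h * h + T.coeff 0 := by
    intro T h
    conv_lhs => rw [← Polynomial.divX_mul_X_add T]
    simp
  refine ⟨S.divX.coeff 0, S.divX.divX.coeff 0, fun h => ⟨S.divX.divX.divX.eval h, ?_⟩⟩
  have h0 : Q.eval a = S.coeff 0 := by
    have := hev 0
    rwa [add_zero, hd S 0, mul_zero, zero_add] at this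
  rw [hev, h0, hd S, hd S.divX, hd S.divX.divX]
  ring

/-- Along a residue class modulo `p`, the sum is a quadratic function modulo `p ^ 2`. -/
theorem exists_oddBinomSum_quadratic (a : ℤ_[p]) :
    ∃ α β : ℤ_[p], ∀ h, (p : ℤ_[p]) ^ 2 ∣
      oddBinomSum p (a + p * h) - (oddBinomSum p a + α * h + p * β * h ^ 2) := by
  obtain ⟨Q, hQ⟩ := exists_eval_eq_prime_mul_oddBinomSum (p := p)
  obtain ⟨α, β, hαβ⟩ := exists_eval_add_eq_quadratic Q a
  have hp0 : (p : ℤ_[p]) ≠ 0 := by exact_mod_cast (Fact.out : p.Prime).ne_zero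
  refine ⟨α, β, fun h => ?_⟩
  -- The expansion is of `p * S`; at increment `p * h` the remainder carries `p ^ 3`, and cancelling
  -- one `p` leaves `p ^ 2`.
  obtain ⟨c, hc⟩ := hαβ (p * h)
  rw [hQ, hQ] at hc
  refine ⟨h ^ 3 * c, mul_left_cancel₀ hp0 ?_⟩
  linear_combination hc

/-! ### The second difference: periodicity and recurrence. -/

/-- The second difference with step `p` of `oddBinomSum p`. -/
noncomputable def oddBinomSumDiff (x : ℤ_[p]) : ℤ_[p] :=
  oddBinomSum p (x + (p : ℤ_[p])) - 2 * oddBinomSum p x + oddBinomSum p (x - p)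

/-- This is a third difference with step `p`, which kills quadratics. -/
theorem oddBinomSumDiff_periodic (x : ℤ_[p]) :
    (p : ℤ_[p]) ^ 2 ∣ oddBinomSumDiff (x + (p : ℤ_[p])) - oddBinomSumDiff x := by
  obtain ⟨α, β, h⟩ := exists_oddBinomSum_quadratic x
  obtain ⟨c₀, h₀⟩ := h (-1)
  obtain ⟨c₁, h₁⟩ := h 1
  obtain ⟨c₂, h₂⟩ := h 2
  refine ⟨c₂ - 3 * c₁ - c₀, ?_⟩
  rw [show x + p * -1 = x - p by ring] at h₀
  rw [mul_one] at h₁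
  rw [show x + p * 2 = x + p + p by ring] at h₂
  rw [oddBinomSumDiff, oddBinomSumDiff, add_sub_cancel_right]
  linear_combination h₂ - 3 * h₁ - h₀

/-- Newton interpolation at `-1, 0, 1`, doubled to avoid halves. -/
theorem oddBinomSum_add_prime_mul (a h : ℤ_[p]) :
    (p : ℤ_[p]) ^ 2 ∣ 2 * (oddBinomSum p (a + p * h) -
      (oddBinomSum p a + h * (oddBinomSum p a - oddBinomSum p (a - p)))) -
      h * (h + 1) * oddBinomSumDiff a := by
  obtain ⟨α, β, H⟩ := exists_oddBinomSum_quadratic a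
  obtain ⟨c₀, h₀⟩ := H (-1)
  obtain ⟨c₁, h₁⟩ := H 1
  obtain ⟨c₂, h₂⟩ := H h
  rw [show a + p * -1 = a - p by ring] at h₀
  rw [mul_one] at h₁
  rw [oddBinomSumDiff]
  refine ⟨2 * c₂ + 2 * h * c₀ - h * (h + 1) * (c₁ + c₀), ?_⟩
  linear_combination 2 * h₂ + 2 * h * h₀ - h * (h + 1) * (h₁ + h₀)

theorem oddBinomSumDiff_add_one_add_sub_one (x : ℤ_[p]) :
    oddBinomSumDiff (x + 1) + oddBinomSumDiff (x - 1) = 2 * (-2) ^ (p - 1) *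
      (oddBinom (p - 1) (x + p) - 2 * oddBinom (p - 1) x + oddBinom (p - 1) (x - p)) := by
  have h : ∀ y : ℤ_[p], oddBinomSum p (y + 1) + oddBinomSum p (y - 1) =
      2 * (-2) ^ (p - 1) * oddBinom (p - 1) y := by
    intro y
    have := oddBinomSum_add_one_add_sub_one (p - 1) y
    rwa [Nat.sub_add_cancel (Fact.out : p.Prime).one_le] at this
  rw [oddBinomSumDiff, oddBinomSumDiff, show x + 1 + (p : ℤ_[p]) = x + p + 1 by ring,
    show x + 1 - (p : ℤ_[p]) = x - p + 1 by ring, show x - 1 + (p : ℤ_[p]) = x + p - 1 by ring,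
    show x - 1 - (p : ℤ_[p]) = x - p - 1 by ring]
  linear_combination h (x + p) - 2 * h x + h (x - p)

theorem prime_dvd_pow_sub_one {n : ℕ} (h : ¬ p ∣ n) : (p : ℤ_[p]) ∣ (n : ℤ_[p]) ^ (p - 1) - 1 := by
  have hp := (Fact.out : p.Prime)
  have hc : IsCoprime (n : ℤ) p := Nat.isCoprime_iff_coprime.2 ((hp.coprime_iff_not_dvd.2 h).symm)
  have h1 := (Int.ModEq.pow_card_sub_one_eq_one hp hc).symm.dvd
  obtain ⟨c, hc⟩ := h1
  exact ⟨c, by exact_mod_cast congrArg (Int.cast : ℤ → ℤ_[p]) hc⟩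

theorem prime_dvd_neg_two_pow_sub_one (hp : Odd p) :
    (p : ℤ_[p]) ∣ (-2) ^ (p - 1) - 1 := by
  have hpp := (Fact.out : p.Prime)
  have h2 : ¬ p ∣ 2 := fun h => by
    have := (Nat.prime_dvd_prime_iff_eq hpp Nat.prime_two).1 h
    rw [this] at hp
    exact absurd hp (by decide)
  rw [(Nat.Odd.sub_odd hp odd_one).neg_pow]
  exact_mod_cast prime_dvd_pow_sub_one h2

/-- For `n + 1 < p` this reads `oddBinom (p - 1) (n + p) ≡ 2 p (1 / n + 1 / (n + 1))` modulo `p ^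
2`. Both binomials reduce to `choose (2 p + n - 1) (n - 1)`, which is 1 modulo `p` by Lucas. -/
theorem exists_mul_oddBinom_add_prime {n : ℕ} (h0 : n ≠ 0) (hn : n < p) :
    ∃ c : ℤ_[p], (n : ℤ_[p]) * (n + 1) * oddBinom (p - 1) ((n : ℤ_[p]) + p) =
      2 * (p : ℤ_[p]) * (1 + p * c) * (2 * p + 2 * n + 1) := by
  have hpp := (Fact.out : p.Prime)
  obtain ⟨l, rfl⟩ := Nat.exists_eq_succ_of_ne_zero h0
  obtain ⟨q, hq⟩ : ∃ q, p = q + 1 := ⟨p - 1, by have := hpp.two_le; omega⟩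
  have hA := Nat.choose_succ_right_eq (2 * p + l) (2 * q)
  have hB := Nat.choose_succ_right_eq (2 * p + l) l
  rw [show 2 * p + l - 2 * q = l + 2 by omega] at hA
  rw [Nat.add_sub_cancel, ← Nat.choose_symm_of_eq_add (show 2 * p + l = (2 * q + 1) + (l + 1) by
    omega)] at hB
  have hC : (p : ℤ) ∣ ((2 * p + l).choose l : ℤ) - 1 := by
    have h := (Choose.choose_modEq_choose_mod_mul_choose_div_nat
      (p := p) (n := 2 * p + l) (k := l))
    rw [Nat.mul_comm 2 p, Nat.mul_add_mod, Nat.mod_eq_of_lt (by omega : l < p), Nat.choose_self,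
      Nat.div_eq_of_lt (by omega : l < p), Nat.choose_zero_right, Nat.mul_one] at h
    have h' := (Nat.modEq_iff_dvd.1 h.symm)
    rw [Nat.mul_comm 2 p]
    exact_mod_cast h'
  obtain ⟨c, hc⟩ := hC
  refine ⟨c, ?_⟩
  have hc' := congrArg (Int.cast : ℤ → ℤ_[p]) hc
  have hA' := congrArg (Nat.cast : ℕ → ℤ_[p]) hA
  have hB' := congrArg (Nat.cast : ℕ → ℤ_[p]) hB
  rw [← Nat.cast_add, oddBinom_natCast, show p - 1 = q by omega,
    show l.succ + p + q = 2 * p + l by rw [Nat.succ_eq_add_one]; omega]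
  have hpq : (p : ℤ_[p]) = q + 1 := by exact_mod_cast congrArg (Nat.cast : ℕ → ℤ_[p]) hq
  push_cast at hA' hB' hc' ⊢
  generalize ((2 * p + l).choose (2 * q) : ℤ_[p]) = A at *
  generalize ((2 * p + l).choose (2 * q + 1) : ℤ_[p]) = B at *
  generalize ((2 * p + l).choose l : ℤ_[p]) = C at *
  have hq' : (q : ℤ_[p]) = p - 1 := by rw [hpq]; ring
  rw [hq'] at hA'
  linear_combination (-(l + 1 : ℤ_[p])) * hA' + (2 * (p : ℤ_[p]) - 1 + 2 * (l + 2)) * hB' +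
    2 * (p : ℤ_[p]) * (2 * p + 2 * l + 3) * hc'

theorem oddBinomSumDiff_recurrence (hp : Odd p) {n : ℕ} (hn : n + 1 < p) :
    (p : ℤ_[p]) ^ 2 ∣ oddBinomSumDiff ((n : ℤ_[p]) + 1) + oddBinomSumDiff ((n : ℤ_[p]) - 1) -
      4 * (p : ℤ_[p]) * ((n : ℤ_[p]) ^ (p - 2) + ((n : ℤ_[p]) + 1) ^ (p - 2)) := by
  have hpp := (Fact.out : p.Prime)
  have hp3 : 3 ≤ p := by
    obtain ⟨m, hm⟩ := hp
    have := hpp.two_le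
    omega
  obtain ⟨a, ha⟩ := prime_dvd_neg_two_pow_sub_one hp
  have e1 : (n : ℤ_[p]) - p = -1 - ((p - 1 - n : ℕ) : ℤ_[p]) := by
    rw [Nat.cast_sub (by omega), Nat.cast_sub (by omega)]
    push_cast
    ring
  rw [oddBinomSumDiff_add_one_add_sub_one, oddBinom_natCast_of_lt (by omega : n < p - 1), e1,
    oddBinom_reflect]
  rcases Nat.eq_zero_or_pos n with rfl | hpos
  -- At `n = 0` there is no inverse of `n`; the convention that fits is `0 ^ (p - 2) = 0`.
  · have e2 : oddBinom (p - 1) (p : ℤ_[p]) = 2 * p + 1 := by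
      have h := oddBinom_succ_self (R := ℤ_[p]) (p - 1)
      rw [Nat.sub_add_cancel hpp.one_le, Nat.cast_sub hpp.one_le] at h
      rw [h]
      push_cast
      ring
    rw [Nat.sub_zero, oddBinom_self, Nat.cast_zero, zero_add, zero_add, e2, one_pow,
      zero_pow (by omega)]
    exact ⟨4 * a, by linear_combination 4 * (p : ℤ_[p]) * ha⟩
  · rw [oddBinom_natCast_of_lt (by omega : p - 1 - n < p - 1)]
    obtain ⟨b, hb⟩ := exists_mul_oddBinom_add_prime (p := p) hpos.ne' (by omega)
    have hn1 : ¬ p ∣ n := fun h => by have := Nat.le_of_dvd hpos h; omega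
    have hn2 : ¬ p ∣ n + 1 := fun h => by have := Nat.le_of_dvd (by omega) h; omega
    obtain ⟨c, hc⟩ := prime_dvd_pow_sub_one hn1
    obtain ⟨d, hd⟩ := prime_dvd_pow_sub_one hn2
    have hu : IsUnit ((n : ℤ_[p]) * (n + 1)) := by
      have h := (isUnit_natCast_of_not_dvd hn1).mul (isUnit_natCast_of_not_dvd hn2)
      exact_mod_cast h
    rw [show p - 1 = p - 2 + 1 by omega, pow_succ] at hc hd
    push_cast at hd
    -- After multiplying by the unit `n (n + 1)`, Fermat lets `n ^ (p - 2)` and `(n + 1) ^ (p - 2)`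
    -- act as inverses modulo `p`.
    rw [← hu.dvd_mul_left]
    refine ⟨4 * ((a + b + p * a * b) * (2 * p + 2 * n + 1) + 2 - (n + 1) * c - n * d), ?_⟩
    linear_combination 2 * (-2) ^ (p - 1) * hb +
      4 * (p : ℤ_[p]) * (1 + p * b) * (2 * p + 2 * n + 1) * ha - 4 * (p : ℤ_[p]) * (n + 1) * hc - 4 * (p : ℤ_[p]) * n * hd

/-- The remaining residue class, where `x + 1` is not invertible. -/
theorem oddBinomSumDiff_recurrence_neg_one (hp : Odd p) :
    (p : ℤ_[p]) ^ 2 ∣ oddBinomSumDiff (-1 + 1 : ℤ_[p]) + oddBinomSumDiff (-1 - 1 : ℤ_[p]) -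
      4 * (p : ℤ_[p]) * ((-1) ^ (p - 2) + (-1 + 1) ^ (p - 2)) := by
  have hpp := (Fact.out : p.Prime)
  have hp3 : 3 ≤ p := by
    obtain ⟨m, hm⟩ := hp
    have := hpp.two_le
    omega
  obtain ⟨a, ha⟩ := prime_dvd_neg_two_pow_sub_one hp
  have e1 : oddBinom (p - 1) (-1 + p : ℤ_[p]) = 1 := by
    have h := oddBinom_self (R := ℤ_[p]) (p - 1)
    rw [Nat.cast_sub hpp.one_le, Nat.cast_one] at h
    rwa [neg_add_eq_sub]
  have e2 : oddBinom (p - 1) (-1 : ℤ_[p]) = 0 := by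
    have h := oddBinom_reflect (p - 1) (0 : ℤ_[p])
    have h' := oddBinom_natCast_of_lt (R := ℤ_[p]) (k := p - 1) (n := 0) (by omega)
    rw [Nat.cast_zero] at h'
    rwa [sub_zero, h', neg_zero] at h
  have e3 : oddBinom (p - 1) (-1 - p : ℤ_[p]) = -(2 * p + 1) := by
    have h := oddBinom_succ_self (R := ℤ_[p]) (p - 1)
    rw [Nat.sub_add_cancel hpp.one_le, Nat.cast_sub hpp.one_le] at h
    rw [oddBinom_reflect, h]
    push_cast
    ring
  rw [oddBinomSumDiff_add_one_add_sub_one, e1, e2, e3, neg_add_cancel, zero_pow (by omega),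
    (Nat.Odd.sub_even (by omega) hp even_two).neg_one_pow]
  exact ⟨-4 * a, by linear_combination -4 * (p : ℤ_[p]) * ha⟩

/-- A function satisfying `W (n + 1) + W (n - 1) = 0` modulo `m` with an odd period `p` is `0`
modulo `m`, if `2` is a unit. -/
theorem dvd_of_antiperiodic_two_of_periodic_odd {R : Type*} [CommRing R] {m i : R} (hi : 2 * i = 1)
    {p : ℕ} (hp : Odd p) {W : R → R} (hper : ∀ x, m ∣ W (x + p) - W x)
    (hrec : ∀ n : ℤ, m ∣ W ((n : R) + 1) + W ((n : R) - 1)) (n : ℤ) : m ∣ W n := by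
  have h1 : ∀ j : ℕ, m ∣ W ((n + 2 * j : ℤ) : R) - (-1) ^ j * W n := by
    intro j
    induction j with
    | zero => simp
    | succ j ih =>
      have h := hrec (n + 2 * j + 1)
      rw [show ((n + 2 * j + 1 : ℤ) : R) + 1 = ((n + 2 * (j + 1 : ℕ) : ℤ) : R) by push_cast; ring,
        show ((n + 2 * j + 1 : ℤ) : R) - 1 = ((n + 2 * j : ℤ) : R) by push_cast; ring] at h
      have := dvd_sub h ih
      convert this using 1
      rw [pow_succ]
      ring
  have h2 := h1 p
  rw [hp.neg_one_pow] at h2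
  -- `W (n + 2 p)` is congruent both to `-W n`, after `p` sign changes, and to `W n`.
  have h3 := dvd_add (hper (n + p)) (hper n)
  rw [show (n : R) + p + p = ((n + 2 * p : ℤ) : R) by push_cast; ring] at h3
  have h4 := (dvd_sub h2 h3).mul_left i
  rwa [show i * (W ((n + 2 * p : ℤ) : R) - -1 * W n - (W ((n + 2 * p : ℤ) : R) - W (n + p) +
    (W (n + p) - W n))) = 2 * i * W n by ring, hi, one_mul] at h4

theorem dvd_intCast_of_periodic {R : Type*} [CommRing R] {m : R} {p : ℕ} (hp : p ≠ 0) {V : R → R}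
    (hper : ∀ x, m ∣ V (x + p) - V x) (h1 : m ∣ V (-1)) (h : ∀ n : ℕ, n + 1 < p → m ∣ V n)
    (n : ℤ) : m ∣ V n := by
  have hnat : ∀ (j : ℕ) (x : R), m ∣ V (x + j * p) - V x := by
    intro j x
    induction j with
    | zero => simp
    | succ j ih =>
      have := dvd_add (hper (x + j * p)) ih
      rwa [sub_add_sub_cancel, show x + j * p + p = x + (j + 1 : ℕ) * p by push_cast; ring] at this
  have hint : ∀ (j : ℤ) (x : R), m ∣ V (x + j * p) ↔ m ∣ V x := by
    intro j x
    obtain ⟨k, rfl | rfl⟩ := j.eq_nat_or_neg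
    · rw [Int.cast_natCast]
      exact (dvd_iff_dvd_of_dvd_sub (hnat k x))
    · have := hnat k (x + ((-k : ℤ) : R) * p)
      rw [show x + ((-k : ℤ) : R) * p + k * p = x by push_cast; ring] at this
      exact (dvd_iff_dvd_of_dvd_sub this).symm
  have hp' : (0 : ℤ) < p := by exact_mod_cast Nat.pos_of_ne_zero hp
  have hlt := Int.emod_lt_of_pos (n + 1) hp'
  have hge := Int.emod_nonneg (n + 1) hp'.ne'
  obtain ⟨r, hr⟩ := Int.eq_ofNat_of_zero_le hge
  -- Reducing `n + 1` makes the representatives run over `-1, ..., p - 2`.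
  have hn : n = ((r : ℤ) - 1) + ((n + 1) / p) * p := by
    have := Int.emod_add_mul_ediv (n + 1) p
    rw [← hr]
    linarith
  rw [hn, Int.cast_add, Int.cast_mul, Int.cast_natCast, hint]
  rcases r with _ | r
  · simpa using h1
  · have := h r (by omega)
    simpa using this

theorem prime_dvd_two_mul_half_pow (hp : Odd p) {i : ℤ_[p]} (hi : 2 * i = 1) :
    (p : ℤ_[p]) ∣ 2 * i ^ (p - 2) - 4 := by
  have hpp := (Fact.out : p.Prime)
  obtain ⟨a, ha⟩ := prime_dvd_neg_two_pow_sub_one hp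
  have hp3 := hpp.two_le
  have h1 : (-2) ^ (p - 1) * i ^ (p - 1) = 1 := by
    rw [(Nat.Odd.sub_odd hp odd_one).neg_pow, ← mul_pow, hi, one_pow]
  have h2 : i ^ (p - 1) = i ^ (p - 2) * i := by
    rw [← pow_succ]
    congr 1
    omega
  refine ⟨-4 * i ^ (p - 1) * a, ?_⟩
  linear_combination -4 * i ^ (p - 1) * ha + 4 * h1 - 4 * h2 - 2 * i ^ (p - 2) * hi

/-- The second difference of `oddBinomSum p`, in terms of a function with the functional equation
of the Euler polynomial of degree `p - 2`. -/
theorem oddBinomSumDiff_modEq (hp : Odd p) {i : ℤ_[p]} (hi : 2 * i = 1)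
    (Q : Polynomial ℤ_[p]) (hQ : ∀ y, Q.eval (y + 1) + Q.eval y = 2 * y ^ (p - 2)) (n : ℤ) :
    (p : ℤ_[p]) ^ 2 ∣ oddBinomSumDiff (n : ℤ_[p]) -
      p * (Q.eval (i * ((n : ℤ_[p]) + 1)) - Q.eval (-(i * (n : ℤ_[p])))) := by
  have hpp := (Fact.out : p.Prime)
  set T : ℤ_[p] → ℤ_[p] := fun x => p * (Q.eval (i * (x + 1)) - Q.eval (-(i * x))) with hT
  have hTper : ∀ x, (p : ℤ_[p]) ^ 2 ∣ T (x + p) - T x := by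
    intro x
    have h1 : (p : ℤ_[p]) ∣ Q.eval (i * (x + p + 1)) - Q.eval (i * (x + 1)) :=
      (Dvd.intro i (by ring)).trans (Polynomial.sub_dvd_eval_sub _ _ _)
    have h2 : (p : ℤ_[p]) ∣ Q.eval (-(i * (x + p))) - Q.eval (-(i * x)) :=
      (Dvd.intro (-i) (by ring)).trans (Polynomial.sub_dvd_eval_sub _ _ _)
    have h3 := mul_dvd_mul_left (p : ℤ_[p]) (dvd_sub h1 h2)
    rw [← sq] at h3
    convert h3 using 1
    simp only [hT]
    ring
  have hTrec : ∀ x, (p : ℤ_[p]) ^ 2 ∣ T (x + 1) + T (x - 1) -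
      4 * (p : ℤ_[p]) * (x ^ (p - 2) + (x + 1) ^ (p - 2)) := by
    intro x
    obtain ⟨c, hc⟩ := prime_dvd_two_mul_half_pow hp hi
    -- The four values of `Q` pair up at `x / 2` and `-(x + 1) / 2`; `p - 2` is odd, so the second
    -- pair enters with the right sign.
    have h1 := hQ (i * x)
    have h2 := hQ (-(i * (x + 1)))
    rw [(Nat.Odd.sub_even hpp.two_le hp even_two).neg_pow, mul_pow] at h2
    rw [mul_pow] at h1
    refine ⟨c * (x ^ (p - 2) + (x + 1) ^ (p - 2)), ?_⟩
    simp only [hT]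
    rw [show i * (x + 1 + 1) = i * x + 1 by linear_combination hi,
      show i * (x - 1 + 1) = i * x by ring,
      show -(i * (x - 1)) = -(i * (x + 1)) + 1 by linear_combination hi]
    linear_combination (p : ℤ_[p]) * h1 - (p : ℤ_[p]) * h2 +
      (p : ℤ_[p]) * (x ^ (p - 2) + (x + 1) ^ (p - 2)) * hc
  have hper : ∀ x, (p : ℤ_[p]) ^ 2 ∣ (oddBinomSumDiff (x + (p : ℤ_[p])) - T (x + p)) -
      (oddBinomSumDiff x - T x) := by
    intro x
    have := dvd_sub (oddBinomSumDiff_periodic x) (hTper x)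
    rwa [sub_sub_sub_comm] at this
  have hrec : ∀ x : ℤ_[p], (p : ℤ_[p]) ^ 2 ∣ oddBinomSumDiff (x + 1) + oddBinomSumDiff (x - 1) -
      4 * (p : ℤ_[p]) * (x ^ (p - 2) + (x + 1) ^ (p - 2)) → (p : ℤ_[p]) ^ 2 ∣
      (oddBinomSumDiff (x + 1) - T (x + 1)) + (oddBinomSumDiff (x - 1) - T (x - 1)) := by
    intro x h
    have := dvd_sub h (hTrec x)
    rwa [sub_sub_sub_cancel_right, add_sub_add_comm] at this
  refine dvd_of_antiperiodic_two_of_periodic_odd hi hp (W := fun x => oddBinomSumDiff x - T x)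
    hper (fun k => ?_) n
  refine dvd_intCast_of_periodic (V := fun x => (oddBinomSumDiff (x + 1) - T (x + 1)) +
    (oddBinomSumDiff (x - 1) - T (x - 1))) hpp.ne_zero (fun x => ?_)
    (hrec _ (oddBinomSumDiff_recurrence_neg_one hp))
    (fun k hk => hrec _ (oddBinomSumDiff_recurrence hp hk)) k
  have := dvd_add (hper (x + 1)) (hper (x - 1))
  rwa [← add_sub_add_comm, add_right_comm x 1, sub_add_eq_add_sub x 1] at this

/-! ### Boundary values and assembly in `ℚ_[p]`. -/

theorem legendreSym_neg_one_eq_pow (hp : Odd p) : legendreSym p (-1) = (-1) ^ (p / 2) := by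
  have h2 : p ≠ 2 := fun h => by rw [h] at hp; exact absurd hp (by decide)
  rw [legendreSym.at_neg_one h2, ZMod.χ₄_eq_neg_one_pow (Nat.odd_iff.1 hp)]

/-- Reflection sends `a - p` to the natural number `p - 1 - a < p`; the rest is the parity of `(p -
1 - a) / 2`. -/
theorem oddBinomSum_natCast_sub_prime (hp : Odd p) {a : ℕ} (ha : a < p) :
    oddBinomSum p ((a : ℤ_[p]) - p) = -((-1) ^ (a / 2) * (-1) ^ a * (-1) ^ (p / 2)) := by
  have e : (a : ℤ_[p]) - p = -1 - ((p - 1 - a : ℕ) : ℤ_[p]) := by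
    rw [Nat.cast_sub (by omega), Nat.cast_sub (by omega)]
    push_cast
    ring
  rw [e, oddBinomSum_reflect, oddBinomSum_natCast (by omega) (Fact.out : p.Prime).two_le,
    ← pow_add, ← pow_add]
  congr 1
  rw [neg_one_pow_eq_pow_mod_two, neg_one_pow_eq_pow_mod_two (n := a / 2 + a + p / 2)]
  congr 1
  obtain ⟨m, rfl⟩ := hp
  obtain ⟨b, rfl | rfl⟩ := a.even_or_odd' <;> omega

/-- Rests on `choose (x + k) (2 k) * choose (2 k) k = choose (x + k) k * choose x k`. -/
theorem coe_oddBinom (k : ℕ) (x : ℤ_[p]) :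
    ((oddBinom k x : ℤ_[p]) : ℚ_[p]) = (2 * (x : ℚ_[p]) + 1) *
      (((Ring.choose x k : ℤ_[p]) : ℚ_[p]) * ((Ring.choose (x + (k : ℤ_[p])) k : ℤ_[p]) : ℚ_[p]) /
        ((2 * (k : ℚ_[p]) + 1) * (Nat.choose (2 * k) k : ℚ_[p]))) := by
  have h1 : (2 * (k : ℚ_[p]) + 1) * ((oddBinom k x : ℤ_[p]) : ℚ_[p]) =
      (2 * (x : ℚ_[p]) + 1) * ((Ring.choose (x + (k : ℤ_[p])) (2 * k) : ℤ_[p]) : ℚ_[p]) := by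
    have := congrArg ((↑) : ℤ_[p] → ℚ_[p]) (mul_oddBinom k x)
    simpa [show ((2 : ℤ_[p]) : ℚ_[p]) = 2 from rfl] using this
  have h2 : ((Nat.choose (2 * k) k : ℕ) : ℚ_[p]) *
      ((Ring.choose (x + (k : ℤ_[p])) (2 * k) : ℤ_[p]) : ℚ_[p]) =
      ((Ring.choose (x + (k : ℤ_[p])) k : ℤ_[p]) : ℚ_[p]) * (Ring.choose x k : ℤ_[p]) := by
    have h := Ring.choose_add_smul_choose x k k
    rw [← two_mul, nsmul_eq_mul] at h
    have := congrArg ((↑) : ℤ_[p] → ℚ_[p]) h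
    simpa using this
  have h3 : (2 * (k : ℚ_[p]) + 1) ≠ 0 := by exact_mod_cast (Nat.succ_ne_zero (2 * k))
  have h4 : ((Nat.choose (2 * k) k : ℕ) : ℚ_[p]) ≠ 0 := by
    exact_mod_cast (Nat.choose_pos (by omega : k ≤ 2 * k)).ne'
  rw [mul_div_assoc', eq_div_iff (mul_ne_zero h3 h4)]
  linear_combination (Nat.choose (2 * k) k : ℚ_[p]) * h1 + (2 * (x : ℚ_[p]) + 1) * h2

theorem coe_oddBinomSum (n : ℕ) (x : ℤ_[p]) :
    ((oddBinomSum n x : ℤ_[p]) : ℚ_[p]) = (2 * (x : ℚ_[p]) + 1) *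
      ∑ k ∈ Finset.range n,
        ((Ring.choose x k : ℤ_[p]) : ℚ_[p]) *
            ((Ring.choose (x + (k : ℤ_[p])) k : ℤ_[p]) : ℚ_[p]) * (-2 : ℚ_[p]) ^ k /
          ((2 * (k : ℚ_[p]) + 1) * (Nat.choose (2 * k) k : ℚ_[p])) := by
  rw [oddBinomSum, PadicInt.coe_sum, mul_sum]
  refine sum_congr rfl fun k _ => ?_
  rw [PadicInt.coe_mul, coe_oddBinom, PadicInt.coe_pow,
    show ((-2 : ℤ_[p]) : ℚ_[p]) = -2 from rfl]
  ring

/-- The congruence with all terms in `ℤ_[p]`. -/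
theorem oddBinomSum_modEq (hp : Odd p) {i : ℤ_[p]} (hi : 2 * i = 1)
    (Q : Polynomial ℤ_[p]) (hQ : ∀ y, Q.eval (y + 1) + Q.eval y = 2 * y ^ (p - 2))
    {a : ℕ} (ha : a < p) {x t : ℤ_[p]} (ht : x = (a : ℤ_[p]) + (p : ℤ_[p]) * t) :
    (p : ℤ_[p]) ^ 2 ∣ oddBinomSum p x -
      ((-1) ^ (a / 2) * (1 + t + (-1) ^ a * (-1) ^ (p / 2) * t) +
        p * t * (t + 1) * i * (Q.eval ((x + 1) * i) - Q.eval (-x * i))) := by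
  obtain ⟨c₁, h₁⟩ := oddBinomSum_add_prime_mul (a : ℤ_[p]) t
  obtain ⟨c₂, h₂⟩ := oddBinomSumDiff_modEq hp hi Q hQ a
  rw [Int.cast_natCast] at h₂
  -- The Euler term already carries a factor `p`, so `a` may be replaced by `x` in its arguments.
  have h3 : (p : ℤ_[p]) ∣ Q.eval ((x + 1) * i) - Q.eval (i * ((a : ℤ_[p]) + 1)) :=
    (Dvd.intro (t * i) (by rw [ht]; ring)).trans (Polynomial.sub_dvd_eval_sub _ _ _)
  have h4 : (p : ℤ_[p]) ∣ Q.eval (-x * i) - Q.eval (-(i * (a : ℤ_[p]))) :=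
    (Dvd.intro (-t * i) (by rw [ht]; ring)).trans (Polynomial.sub_dvd_eval_sub _ _ _)
  obtain ⟨c₃, h₃⟩ := h3
  obtain ⟨c₄, h₄⟩ := h4
  rw [← ht, oddBinomSum_natCast ha (Fact.out : p.Prime).two_le,
    oddBinomSum_natCast_sub_prime hp ha] at h₁
  refine ⟨i * (c₁ + t * (t + 1) * (c₂ - (c₃ - c₄))), ?_⟩
  linear_combination i * h₁ + i * t * (t + 1) * h₂ - i * t * (t + 1) * (p : ℤ_[p]) * (h₃ - h₄) -
    (oddBinomSum p x - (-1) ^ (a / 2) * (1 + t + (-1) ^ a * (-1) ^ (p / 2) * t)) * hi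

end Padic

end

/-- The congruence modulo `p ^ 2` says that the difference of the two sides, a `p`-adic number,
lies in `p ^ 2 ℤ_p`; `x.zmodRepr` is the least nonnegative residue of `x` modulo `p`. -/
theorem theorem1p3 (p : ℕ) [Fact p.Prime] (hp : Odd p) (x t : ℤ_[p])
    (ht : x = (x.zmodRepr : ℤ_[p]) + (p : ℤ_[p]) * t) :
    ∃ c : ℤ_[p],
      (2 * (x : ℚ_[p]) + 1) *
          ∑ k ∈ Finset.range p,
            ((Ring.choose x k : ℤ_[p]) : ℚ_[p]) *
                ((Ring.choose (x + (k : ℤ_[p])) k : ℤ_[p]) : ℚ_[p]) * (-2 : ℚ_[p]) ^ k /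
              ((2 * (k : ℚ_[p]) + 1) * (Nat.choose (2 * k) k : ℚ_[p])) -
        ((-1 : ℚ_[p]) ^ (x.zmodRepr / 2) *
            (1 + (t : ℚ_[p]) +
              (-1 : ℚ_[p]) ^ x.zmodRepr * ((legendreSym p (-1) : ℤ) : ℚ_[p]) * (t : ℚ_[p])) +
          (p : ℚ_[p]) * (t : ℚ_[p]) * ((t : ℚ_[p]) + 1) / 2 *
            (Polynomial.aeval (((x : ℚ_[p]) + 1) / 2) (eulerPoly (p - 2)) -
              Polynomial.aeval (-(x : ℚ_[p]) / 2) (eulerPoly (p - 2)))) =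
      (p : ℚ_[p]) ^ 2 * (c : ℚ_[p]) := by
  obtain ⟨i, hi⟩ := exists_padicInt_half hp
  obtain ⟨Q, hQ⟩ := exists_padicInt_eulerPoly hp (p - 2)
  have hi' : (i : ℚ_[p]) = 1 / 2 := by
    have h : (2 : ℚ_[p]) * i = 1 := congrArg ((↑) : ℤ_[p] → ℚ_[p]) hi
    rw [eq_div_iff two_ne_zero, mul_comm, h]
  have hQ' : ∀ y, Q.eval (y + 1) + Q.eval y = 2 * y ^ (p - 2) := by
    intro y
    have h := aeval_eulerPoly_add_one_add (p - 2) (y : ℚ_[p])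
    rw [← PadicInt.coe_one, ← PadicInt.coe_add, hQ, hQ] at h
    exact Subtype.ext h
  obtain ⟨c, hc⟩ := oddBinomSum_modEq hp hi Q hQ' x.zmodRepr_lt_p ht
  refine ⟨c, ?_⟩
  have hc' := congrArg ((↑) : ℤ_[p] → ℚ_[p]) hc
  push_cast at hc'
  rw [← hQ, ← hQ, coe_oddBinomSum] at hc'
  push_cast at hc'
  rw [legendreSym_neg_one_eq_pow hp, ← hc', hi']
  push_cast
  simp only [div_eq_mul_inv, one_mul]
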